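/- Multigraphs are undirected, loopless and may have parallel edges. For integers $a,b\ge 1$, $K_{m+1}^{a,b}$ denotes the complete multigraph on $m+1$ vertices, one of which is the root $0$, with exactly $a$ edges between $0$ and each other vertex and exactly $b$ edges between any two distinct non-root vertices. Let $\mathbb K$ be a field, let $n\ge 0$ and $a\ge 1$ be integers, and let $G$ be a spanning subgraph of $K_{n+1}^{a,1}$, on the vertex set $\{0,1,\ldots,n\}$ with root $0$. Let $a_{i,j}$ be the number of edges of $G$ between $i$ and $j$ (so $a_{i,i}=0$); for $\emptyset\ne S\subseteq[n]=\{1,\ldots,n\}$ and $i\in S$ let $d_S(i)=\sum_{j\in\{0,\ldots,n\}\setminus S}a_{i,j}$. Let $R=\mathbb K[x_1,\ldots,x_n]$ and $$\mathcal M_G^{(1)}=\Big\langle \prod_{i\in S}x_i^{d_S(i)}\ :\ \emptyset\ne S\subseteq[n],\ |S|\le 2\Big\rangle\subseteq R .$$ Let $Q_G=D+A$ be the signless Laplace matrix of $G$, where $A=[a_{i,j}]$ and $D$ is the diagonal matrix of the vertex degrees, and let $\widetilde Q_G$ be $Q_G$ with the row and the column of $0$ deleted. An essentially connected component of $G$ is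 a subgraph of $G$ induced on $C\cup\{0\}$, where $C$ is the vertex set of a connected component of the subgraph of $G$ induced on $[n]$. Then $R/\mathcal M_G^{(1)}$ is finite-dimensional over $\mathbb K$, and the following hold. 1. If every essentially connected component $G_i$ of $G$ is obtained, for some $a_i\ge 1$ and with $n_i+1=|V(G_i)|$, from a complete multigraph $K_{n_i+1}^{a_i,1}$ with root $0$ by deleting some (possibly none, possibly all) of the edges through $0$, then $\dim_{\mathbb K}(R/\mathcal M_G^{(1)})=\det\widetilde Q_G$. 2. Conversely, if $\mathcal M_G^{(1)}\ne R$ and $\dim_{\mathbb K}(R/\mathcal M_G^{(1)})=\det\widetilde Q_G$, then every essentially connected component of $G$ is obtained in this way. In particular, if $\mathcal M_G^{(1)}\neq R$, then $\dim_{\mathbb K}(R/\mathcal M_G^{(1)})=\det\widetilde Q_G$ if and only if every essentially connected component of $G$ is obtained in this way. -/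

import Mathlib

open scoped Graph

noncomputable section

/-- The number `a_{x,y} = |E(x,y)|` of edges of the multigraph `G` joining `x` and `y`. -/
def edgeCount {α β : Type*} (G : Graph α β) (x y : α) : ℕ :=
  {e | G.IsLink e x y}.ncard

/-- `K` is (a copy of) the complete multigraph `K_{m+1}^{a,b}` with root `r`: it is loopless and has
`m + 1` vertices, among them `r`; exactly `a` edges join `r` to each other vertex, and exactly `b`
edges join any two distinct vertices other than `r`. (Used only for `a, b ≥ 1`; then all the edge
sets are finite.) -/
structure IsCompleteMultigraph {α β : Type*} (K : Graph α β) (r : α) (m a b : ℕ) : Prop where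
  finite : K.vertexSet.Finite
  card : K.vertexSet.ncard = m + 1
  root_mem : r ∈ K.vertexSet
  loopless : ∀ e x, ¬ K.IsLoopAt e x
  root_edges : ∀ x ∈ K.vertexSet, x ≠ r → edgeCount K r x = a
  nonroot_edges : ∀ x ∈ K.vertexSet, ∀ y ∈ K.vertexSet, x ≠ r → y ≠ r → x ≠ y →
    edgeCount K x y = b

/-- `H` is obtained from `K` by deleting some (possibly none, possibly all) of the edges through
the vertex `r`. -/
def IsRootEdgeDeletion {α β : Type*} (H K : Graph α β) (r : α) : Prop :=
  ∃ F : Set β, (∀ e ∈ F, K.Inc e r) ∧ H = K.deleteEdges F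

/-- `H` is obtained from some complete multigraph `K_{m+1}^{c,1}` with root `r` by deleting some edges
through `r`. -/
def IsRootDeletedComplete {α β : Type*} (H : Graph α β) (r : α) : Prop :=
  ∃ (m c : ℕ) (K : Graph α β), 1 ≤ c ∧ IsCompleteMultigraph K r m c 1 ∧ IsRootEdgeDeletion H K r

/-- `C` is the vertex set of a connected component of the multigraph `H`. -/
def IsComponentVertexSet {α β : Type*} (H : Graph α β) (C : Set α) : Prop :=
  ∃ v ∈ H.vertexSet, C = {w | Relation.ReflTransGen H.Adj v w}

/-- `G₁` is an essentially connected component of `G` with respect to the root `r`: the subgraph of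
`G` induced on `C ∪ {r}`, where `C` is the vertex set of a connected component of the subgraph
of `G` induced on the vertices other than `r`. -/
def IsEssentialComponent {α β : Type*} (G : Graph α β) (r : α) (G₁ : Graph α β) : Prop :=
  ∃ C : Set α, IsComponentVertexSet (G.induce (G.vertexSet \ {r})) C ∧ G₁ = G.induce (insert r C)

/-- `d_S(i)`, the number of edges from `i ∈ S` to vertices outside `S`. -/
def cutDegree {n : ℕ} {β : Type*} (G : Graph (Fin (n + 1)) β) (S : Finset (Fin (n + 1)))
    (i : Fin (n + 1)) : ℕ :=
  ∑ j ∈ Sᶜ, edgeCount G i j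

/-- The `k`-skeleton ideal `M_G^{(k)}` of a multigraph `G` on `{0, …, n}` with root `0`. The nonroot
vertices `1, …, n` are the elements `i.succ`, for `i : Fin n`, and the variable of the
vertex `i.succ` is `X i`. -/
def skeletonIdeal (𝕂 : Type*) [Field 𝕂] {n : ℕ} {β : Type*} (G : Graph (Fin (n + 1)) β) (k : ℕ) :
    Ideal (MvPolynomial (Fin n) 𝕂) :=
  Ideal.span {m | ∃ S : Finset (Fin n), S.Nonempty ∧ S.card ≤ k + 1 ∧
    m = ∏ i ∈ S, MvPolynomial.X i ^ cutDegree G (S.map (Fin.succEmb n)) i.succ}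

/-- The signless Laplace matrix `Q_G = D(G) + A(G)` of a (loopless) multigraph on `{0, …, n}`. -/
def signlessLaplacian {n : ℕ} {β : Type*} (G : Graph (Fin (n + 1)) β) :
    Matrix (Fin (n + 1)) (Fin (n + 1)) ℤ :=
  Matrix.diagonal (fun i => (cutDegree G {i} i : ℤ)) + Matrix.of (fun i j => (edgeCount G i j : ℤ))

/-- The truncated signless Laplace matrix: the row and the column of the root `0` are deleted. -/
def truncatedSignlessLaplacian {n : ℕ} {β : Type*} (G : Graph (Fin (n + 1)) β) :
    Matrix (Fin n) (Fin n) ℤ :=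
  (signlessLaplacian G).submatrix Fin.succ Fin.succ

end

/-!
Let `H` be the simple graph that `G` induces on the vertices other than the root, and let `d i` be
the degree of `i` in `G`; in particular `d i` is at least the degree of `i` in `H`. Both sides
of the identity are functions of `H` and `d`, and they obey the same recursion up to an error term
that Fischer's inequality controls.

*The dimension.* The monomials outside the ideal form a basis of the quotient. Their exponent
vectors `m` are those with `m i < d i` for all `i`, such that `m i = d i - 1` holds on an
independent set of `H` only (`mem_standardExponents_iff`). Sorting them by that independent set
gives, if all `d i ≥ 1`, the dimension `∑ I, ∏ i ∉ I, (d i - 1)` over the independent sets `I`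
(`indepSum`, `card_standardExponents`). Splitting according to whether `p ∈ I` gives
`N(S) = (d p - 1) N(S \ p) + ∏ i ∈ U, (d i - 1) · N(S \ p \ U)`, where `U` is the set of
neighbours of `p` in `S` (`indepSum_insert`).

*The determinant.* The truncated signless Laplacian is `M = diag d + A(H)`. Expanding in the
diagonal entry at `p` gives `det M_S = (d p - 1) det M_{S \ p} + det M'`, where
`M' = M_{S \ p} - b bᵀ` and `b` is the adjacency vector of `p`
(`principalMinor_insert_eq_add_pivoted`). The diagonal entries of `M'` on `U` are `d i - 1`, and
outside `U` the matrices `M'` and `M` agree.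

If `H` is a disjoint union of complete graphs, the rows of `M'` indexed by `U` vanish off the
diagonal, so both quantities obey the same recursion and agree (`principalMinor_eq_indepSum`).

In general `M` is positive semidefinite. Let all `d i ≥ 1`. If `M` is definite, then `M'` is
positive definite or has a determinant that is not positive, so Fischer's inequality gives
`det M' ≤ ∏ i ∈ U, (d i - 1) · det M_{S \ p \ U}`, whence `det M_S ≤ N(S)` by induction
(`principalMinor_le_indepSum`). Fischer's inequality is strict if a row of `M'` indexed by `U` has
a nonzero entry off the diagonal and `d > 1` on `U`. An induced path `u, v, w` in `H` always yields
a pivot `p` for which this happens (`adj_of_det_eq_indepSum`): `p = v`, where `M' u w = -1`, or a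
neighbour `p` of `v` with `d p = 1`, whose only neighbour is `v`. So equality, with a nonzero
value as the ideal is proper, forces adjacency in `H` to be transitive, which says that each
essentially connected component arises from a complete multigraph by deletion of edges at the root.
-/

/-! ### Positive definite principal submatrices -/

section PosDefOn

variable {V : Type*} {M : Matrix V V ℝ} {S T : Finset V}

/-- Positive definiteness of the principal submatrix on `S`. -/
def PosDefOn (M : Matrix V V ℝ) (S : Finset V) : Prop :=
  (M.submatrix (Subtype.val : {x // x ∈ S} → V) Subtype.val).PosDef

lemma PosDefOn.mono (h : PosDefOn M S) (hT : T ⊆ S) : PosDefOn M T :=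
  Matrix.PosDef.submatrix (e := fun x : {x // x ∈ T} => (⟨x, hT x.2⟩ : {x // x ∈ S})) h
    (fun _ _ hxy => Subtype.ext (congrArg (fun z : {x // x ∈ S} => (z : V)) hxy))

lemma PosDefOn.apply_self_pos (h : PosDefOn M S) {i : V} (hi : i ∈ S) : 0 < M i i :=
  Matrix.PosDef.diag_pos h (i := ⟨i, hi⟩)

lemma PosDefOn.symm (h : PosDefOn M S) {i j : V} (hi : i ∈ S) (hj : j ∈ S) : M i j = M j i := by
  simpa using (h.isHermitian.apply ⟨j, hj⟩ ⟨i, hi⟩)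

end PosDefOn

/-! ### Principal minors and Fischer's inequality -/

section PrincipalMinors

variable {V : Type*} [DecidableEq V] {R : Type*}

/-- The principal minor of `M` on the index set `S`. -/
def principalMinor [CommRing R] (M : Matrix V V R) (S : Finset V) : R :=
  (M.submatrix (Subtype.val : {x // x ∈ S} → V) Subtype.val).det

/-- The principal submatrix on `insert p T`, with the row and the column of `p` split off. -/
def bordered (M : Matrix V V R) (p : V) (T : Finset V) :
    Matrix (Unit ⊕ {x // x ∈ T}) (Unit ⊕ {x // x ∈ T}) R :=
  Matrix.fromBlocks (Matrix.of fun _ _ => M p p) (Matrix.of fun _ j => M p j)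
    (Matrix.of fun i _ => M i p) (M.submatrix Subtype.val Subtype.val)

/-- The index map which identifies `Unit ⊕ T` with `insert p T`. -/
def insertIndex (p : V) (T : Finset V) : Unit ⊕ {x // x ∈ T} → {x // x ∈ insert p T} :=
  Sum.elim (fun _ => ⟨p, Finset.mem_insert_self p T⟩)
    (fun x => ⟨x, Finset.mem_insert_of_mem x.2⟩)

lemma insertIndex_bijective {p : V} {T : Finset V} (hp : p ∉ T) :
    Function.Bijective (insertIndex p T) := by
  constructor
  · rintro (⟨⟩ | ⟨x, hx⟩) (⟨⟩ | ⟨y, hy⟩) h <;> simp [insertIndex] at h ⊢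
    · subst h; exact hp hy
    · subst h; exact hp hx
    · exact h
  · rintro ⟨x, hx⟩
    rcases Finset.mem_insert.1 hx with rfl | h
    · exact ⟨Sum.inl (), rfl⟩
    · exact ⟨Sum.inr ⟨x, h⟩, rfl⟩

lemma submatrix_insertIndex (M : Matrix V V R) (p : V) (T : Finset V) :
    (M.submatrix (Subtype.val : {x // x ∈ insert p T} → V) Subtype.val).submatrix
      (insertIndex p T) (insertIndex p T) = bordered M p T := by
  ext (i | i) (j | j) <;> rfl

section CommRing

variable [CommRing R]

lemma principalMinor_empty (M : Matrix V V R) : principalMinor M ∅ = 1 :=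
  Matrix.det_isEmpty

lemma principalMinor_univ [Fintype V] (M : Matrix V V R) :
    principalMinor M Finset.univ = M.det := by
  rw [principalMinor,
    ← Matrix.det_submatrix_equiv_self (Equiv.subtypeUnivEquiv (Finset.mem_univ (α := V))) M]
  rfl

lemma principalMinor_congr {M N : Matrix V V R} {S : Finset V}
    (h : ∀ i ∈ S, ∀ j ∈ S, M i j = N i j) : principalMinor M S = principalMinor N S := by
  unfold principalMinor
  congr 1
  ext i j
  exact h i i.2 j j.2

lemma principalMinor_insert (M : Matrix V V R) {p : V} {T : Finset V} (hp : p ∉ T) :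
    principalMinor M (insert p T) = (bordered M p T).det := by
  rw [← submatrix_insertIndex]
  exact (Matrix.det_submatrix_equiv_self (Equiv.ofBijective _ (insertIndex_bijective hp)) _).symm

lemma principalMinor_insert_of_row_eq_zero (M : Matrix V V R) {p : V} {T : Finset V} (hp : p ∉ T)
    (h : ∀ j ∈ T, M p j = 0) : principalMinor M (insert p T) = M p p * principalMinor M T := by
  have hB : (Matrix.of fun (_ : Unit) (j : {x // x ∈ T}) => M p j) = 0 := by
    ext i j; exact h j j.2
  rw [principalMinor_insert M hp, bordered, hB, Matrix.det_fromBlocks_zero₁₂]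
  simp [principalMinor]

/-- Pivoting on `p` as if its diagonal entry were `1`: the error is `M p p - 1` times the minor
without `p`. -/
lemma principalMinor_insert_eq_add (M : Matrix V V R) {p : V} {T : Finset V} (hp : p ∉ T) :
    principalMinor M (insert p T) = (M p p - 1) * principalMinor M T +
      principalMinor (M - Matrix.vecMulVec (fun i => M i p) (M p)) T := by
  set B : Matrix Unit {x // x ∈ T} R := Matrix.of fun _ j => M p j with hB
  set C : Matrix {x // x ∈ T} Unit R := Matrix.of fun i _ => M i p with hC
  set D := M.submatrix (Subtype.val : {x // x ∈ T} → V) Subtype.val with hD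
  have h1 : ∀ (c : R) (B' : Matrix Unit {x // x ∈ T} R),
      Matrix.fromBlocks (Matrix.of fun _ _ => c) B' C D =
      (Matrix.fromBlocks 1 B C D).updateRow (Sum.inl ()) (Sum.elim (fun _ => c) (B' ())) := by
    intro c B'
    ext (i | i) (j | j) <;> simp [Matrix.updateRow_apply]
  have h2 : (Sum.elim (fun _ => M p p) (B ()) : Unit ⊕ {x // x ∈ T} → R) =
      Sum.elim (fun _ => M p p - 1) ((0 : Matrix Unit {x // x ∈ T} R) ()) +
        Sum.elim (fun _ => 1) (B ()) := by
    ext (i | i) <;> simp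
  have h3 : (Matrix.of fun _ _ => 1 : Matrix Unit Unit R) = 1 := by
    ext ⟨⟩ ⟨⟩; simp
  rw [principalMinor_insert M hp, bordered, ← hB, ← hC, ← hD, h1, h2, Matrix.det_updateRow_add,
    ← h1, ← h1, h3, Matrix.det_fromBlocks_zero₁₂, Matrix.det_fromBlocks_one₁₁]
  congr 1
  · simp [principalMinor, hD]
  · rw [principalMinor]
    congr 1
    ext i j
    simp [hB, hC, hD, Matrix.mul_apply, Matrix.vecMulVec_apply]

/-- If the rows of `M` indexed by `U` have only zeros off the diagonal within `S`, then they
contribute their diagonal entries to the principal minor on `S`. -/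
lemma principalMinor_eq_prod_mul (M : Matrix V V R) (S U : Finset V) (hU : U ⊆ S)
    (h : ∀ i ∈ U, ∀ j ∈ S, j ≠ i → M i j = 0) :
    principalMinor M S = (∏ i ∈ U, M i i) * principalMinor M (S \ U) := by
  induction U using Finset.induction_on generalizing S with
  | empty => simp
  | insert u U hu ih =>
    have huS : u ∈ S := hU (Finset.mem_insert_self u U)
    have hS : insert u (S.erase u) = S := Finset.insert_erase huS
    rw [← hS, principalMinor_insert_of_row_eq_zero M (Finset.notMem_erase u S)
      (fun j hj => h u (Finset.mem_insert_self u U) j (Finset.mem_of_mem_erase hj)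
        (Finset.ne_of_mem_erase hj)), hS,
      ih (S.erase u) (fun i hi => Finset.mem_erase.2 ⟨fun h => hu (h ▸ hi),
        hU (Finset.mem_insert_of_mem hi)⟩)
        (fun i hi j hj => h i (Finset.mem_insert_of_mem hi) j (Finset.mem_of_mem_erase hj)),
      Finset.prod_insert hu, mul_assoc]
    congr 3
    grind

end CommRing

section Real

variable {M : Matrix V V ℝ} {p : V} {S T U : Finset V}

lemma PosDefOn.principalMinor_pos (h : PosDefOn M S) : 0 < principalMinor M S :=
  Matrix.PosDef.det_pos h

/-- The Schur complement formula, with the block on `T` as pivot. -/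
lemma principalMinor_insert_eq_schur (hp : p ∉ T) (h : PosDefOn M (insert p T)) :
    principalMinor M (insert p T) = principalMinor M T * (M p p -
      (fun j : {x // x ∈ T} => M p j) ⬝ᵥ
        ((M.submatrix (Subtype.val : {x // x ∈ T} → V) Subtype.val)⁻¹.mulVec
          (fun j : {x // x ∈ T} => M p j))) := by
  have hT := h.mono (Finset.subset_insert p T)
  have hu := Matrix.PosDef.isUnit hT
  have := hu.invertible
  rw [principalMinor_insert M hp, bordered, Matrix.det_fromBlocks₂₂, principalMinor]
  congr 1
  rw [Matrix.det_unique]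
  have : (Matrix.of fun (i : {x // x ∈ T}) (_ : Unit) => M i p) =
      Matrix.of fun (i : {x // x ∈ T}) (_ : Unit) => M p i := by
    ext i j
    exact h.symm (Finset.mem_insert_of_mem i.2) (Finset.mem_insert_self p T)
  rw [this, Matrix.mul_assoc, Matrix.invOf_eq_nonsing_inv]
  simp [Matrix.mul_apply, dotProduct, Matrix.mulVec]

lemma principalMinor_insert_le (hp : p ∉ T) (h : PosDefOn M (insert p T)) :
    principalMinor M (insert p T) ≤ M p p * principalMinor M T := by
  have hT := h.mono (Finset.subset_insert p T)
  have hq := (Matrix.PosDef.inv hT).posSemidef.dotProduct_mulVec_nonneg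
    (fun j : {x // x ∈ T} => M p j)
  rw [star_trivial] at hq
  rw [principalMinor_insert_eq_schur hp h]
  nlinarith [hT.principalMinor_pos]

lemma principalMinor_insert_lt (hp : p ∉ T) (h : PosDefOn M (insert p T)) {j : V} (hj : j ∈ T)
    (hpj : M p j ≠ 0) : principalMinor M (insert p T) < M p p * principalMinor M T := by
  have hT := h.mono (Finset.subset_insert p T)
  have hq := (Matrix.PosDef.inv hT).dotProduct_mulVec_pos
    (x := fun j : {x // x ∈ T} => M p j) (fun h0 => hpj (congrFun h0 ⟨j, hj⟩))
  rw [star_trivial] at hq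
  rw [principalMinor_insert_eq_schur hp h]
  nlinarith [hT.principalMinor_pos, mul_pos hT.principalMinor_pos hq]

/-- Fischer's inequality, with the block on `U` replaced by its diagonal. -/
lemma principalMinor_le_prod_mul (h : PosDefOn M S) (hU : U ⊆ S) :
    principalMinor M S ≤ (∏ i ∈ U, M i i) * principalMinor M (S \ U) := by
  induction U using Finset.induction_on generalizing S with
  | empty => simp
  | insert u U hu ih =>
    have huS : u ∈ S := hU (Finset.mem_insert_self u U)
    have hS : insert u (S.erase u) = S := Finset.insert_erase huS
    have h1 := principalMinor_insert_le (Finset.notMem_erase u S) (hS.symm ▸ h)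
    have h2 := ih (h.mono (Finset.erase_subset u S)) (fun i hi => Finset.mem_erase.2
      ⟨fun h => hu (h ▸ hi), hU (Finset.mem_insert_of_mem hi)⟩)
    have h3 : S.erase u \ U = S \ insert u U := by grind
    rw [hS] at h1
    rw [Finset.prod_insert hu, mul_assoc, ← h3]
    exact h1.trans (mul_le_mul_of_nonneg_left h2 (h.apply_self_pos huS).le)

/-- Fischer's inequality is strict as soon as some row that is split off has a nonzero entry off
the diagonal. -/
lemma principalMinor_lt_prod_mul (h : PosDefOn M S) (hU : U ⊆ S) {u j : V} (hu : u ∈ U)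
    (hj : j ∈ S) (hju : j ≠ u) (huj : M u j ≠ 0) :
    principalMinor M S < (∏ i ∈ U, M i i) * principalMinor M (S \ U) := by
  have hS : insert u (S.erase u) = S := Finset.insert_erase (hU hu)
  have h1 := principalMinor_insert_lt (Finset.notMem_erase u S) (hS.symm ▸ h)
    (Finset.mem_erase.2 ⟨hju, hj⟩) huj
  have h2 := principalMinor_le_prod_mul (h.mono (Finset.erase_subset u S))
    (Finset.erase_subset_erase u hU)
  have h3 : S.erase u \ U.erase u = S \ U := by grind
  rw [hS] at h1
  rw [← Finset.mul_prod_erase U _ hu, mul_assoc, ← h3]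
  exact h1.trans_le (mul_le_mul_of_nonneg_left h2 (h.apply_self_pos (hU hu)).le)

/-- Subtracting the rank one matrix `b bᵀ` from a positive definite matrix leaves it positive
definite, if the determinant stays positive: both statements say `bᵀ M⁻¹ b < 1`. -/
lemma PosDefOn.sub_vecMulVec {b : V → ℝ} (h : PosDefOn M T)
    (hdet : 0 < principalMinor (M - Matrix.vecMulVec b b) T) :
    PosDefOn (M - Matrix.vecMulVec b b) T := by
  set D := M.submatrix (Subtype.val : {x // x ∈ T} → V) Subtype.val with hD
  set B : Matrix Unit {x // x ∈ T} ℝ := Matrix.of fun _ j => b j with hB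
  have hE : (M - Matrix.vecMulVec b b).submatrix (Subtype.val : {x // x ∈ T} → V) Subtype.val =
      D - B.conjTranspose * (1 : Matrix Unit Unit ℝ)⁻¹ * B := by
    ext i j
    simp [hB, hD, Matrix.mul_apply, Matrix.vecMulVec_apply]
  have hPD : D.PosDef := h
  have := (Matrix.PosDef.isUnit hPD).invertible
  have hone : (1 : Matrix Unit Unit ℝ).PosDef := Matrix.PosDef.one
  -- `D - b bᵀ` and `1 - bᵀ D⁻¹ b` are the two Schur complements of the matrix with blocks
  -- `1`, `bᵀ`, `b`, `D`, whose determinant and definiteness can be read off from either.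
  have h0 : (0 : ℝ) < D.det * (1 - B * D⁻¹ * B.conjTranspose).det := by
    rw [← Matrix.invOf_eq_nonsing_inv, ← Matrix.det_fromBlocks₂₂, Matrix.det_fromBlocks_one₁₁]
    rw [principalMinor, hE] at hdet
    simpa using hdet
  have h1 : 0 < (1 - B * D⁻¹ * B.conjTranspose).det := by
    exact (mul_pos_iff_of_pos_left hPD.det_pos).1 h0
  have h2 : (1 - B * D⁻¹ * B.conjTranspose).PosSemidef := by
    have : (1 - B * D⁻¹ * B.conjTranspose) =
        Matrix.diagonal (fun _ : Unit => (1 - B * D⁻¹ * B.conjTranspose).det) := by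
      ext ⟨⟩ ⟨⟩
      rw [Matrix.det_unique]
      simp
    rw [this]
    exact Matrix.PosSemidef.diagonal fun _ => h1.le
  have hone' := hone.isUnit.invertible
  have h3 : (Matrix.fromBlocks 1 B B.conjTranspose D).PosSemidef := by
    exact (Matrix.PosDef.fromBlocks₂₂ (1 : Matrix Unit Unit ℝ) B hPD).2 h2
  have h4 := (Matrix.PosDef.fromBlocks₁₁ B D hone).1 h3
  rw [← hE] at h4
  exact h4.posDef_iff_isUnit.2 ((Matrix.isUnit_iff_isUnit_det _).2 hdet.ne'.isUnit)

end Real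

end PrincipalMinors

/-! ### The independent set sum and the determinant -/

section IndependentSets

variable {V : Type*} [DecidableEq V] (H : SimpleGraph V) [DecidableRel H.Adj]
  {R : Type*} [CommRing R]

/-- The sum of `∏ i ∈ S \ I, (d i - 1)` over the independent subsets `I` of `S`. -/
def indepSum (d : V → R) (S : Finset V) : R :=
  ∑ I ∈ S.powerset, if H.IsIndepSet (I : Set V) then ∏ i ∈ S \ I, (d i - 1) else 0

/-- The matrix with diagonal `d` whose off-diagonal part is the adjacency matrix of `H`. -/
def diagonalAddAdj (d : V → R) : Matrix V V R :=
  Matrix.diagonal d + H.adjMatrix R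

variable {H} {d : V → R}

lemma indepSum_empty : indepSum H d ∅ = 1 := by
  rw [indepSum, Finset.powerset_empty, Finset.sum_singleton, if_pos (by simp)]
  simp

lemma diagonalAddAdj_self (i : V) : diagonalAddAdj H d i i = d i := by
  simp [diagonalAddAdj]

lemma diagonalAddAdj_of_ne {i j : V} (h : i ≠ j) :
    diagonalAddAdj H d i j = if H.Adj i j then 1 else 0 := by
  simp [diagonalAddAdj, h, SimpleGraph.adjMatrix_apply]

lemma diagonalAddAdj_comm (i j : V) : diagonalAddAdj H d i j = diagonalAddAdj H d j i := by
  by_cases h : i = j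
  · rw [h]
  · rw [diagonalAddAdj_of_ne h, diagonalAddAdj_of_ne (Ne.symm h)]
    simp only [H.adj_comm]

lemma map_indepSum {R' : Type*} [CommRing R'] (f : R →+* R') (S : Finset V) :
    f (indepSum H d S) = indepSum H (fun i => f (d i)) S := by
  simp [indepSum, map_sum, apply_ite f, map_prod]

/-- Independent sets either avoid `p`, or contain `p` and avoid its neighbours. -/
lemma indepSum_insert {p : V} {T : Finset V} (hp : p ∉ T) :
    indepSum H d (insert p T) = (d p - 1) * indepSum H d T +
      (∏ i ∈ T with H.Adj p i, (d i - 1)) * indepSum H d {i ∈ T | ¬ H.Adj p i} := by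
  unfold indepSum
  rw [Finset.sum_powerset_insert hp]
  congr 1
  · rw [Finset.mul_sum]
    refine Finset.sum_congr rfl fun I hI => ?_
    have hpI : p ∉ I := fun h => hp (Finset.mem_powerset.1 hI h)
    have hpT : p ∉ T \ I := fun h => hp (Finset.mem_sdiff.1 h).1
    rw [Finset.insert_sdiff_of_notMem _ hpI, Finset.prod_insert hpT, mul_ite, mul_zero]
  · rw [Finset.mul_sum]
    have hsub : ({i ∈ T | ¬ H.Adj p i} : Finset V).powerset ⊆ T.powerset :=
      Finset.powerset_mono.2 (Finset.filter_subset _ _)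
    rw [← Finset.sum_subset hsub]
    · refine Finset.sum_congr rfl fun I hI => ?_
      rw [Finset.mem_powerset] at hI
      have hiff : H.IsIndepSet ((insert p I : Finset V) : Set V) ↔ H.IsIndepSet (I : Set V) := by
        rw [Finset.coe_insert]
        refine ⟨fun h => h.mono (Set.subset_insert _ _), fun h => ?_⟩
        refine Set.Pairwise.insert h fun j hj _ => ?_
        have := (Finset.mem_filter.1 (hI hj)).2
        exact ⟨this, fun h => this h.symm⟩
      have hsplit : insert p T \ insert p I =
          ({i ∈ T | H.Adj p i} : Finset V) ∪ ({i ∈ T | ¬ H.Adj p i} : Finset V) \ I := by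
        ext x
        have := @hI x
        simp only [Finset.mem_sdiff, Finset.mem_insert, Finset.mem_union, Finset.mem_filter] at *
        by_cases hx : x = p
        · subst hx; simp [hp]
        · grind
      rw [hsplit, Finset.prod_union, mul_ite, mul_zero]
      · simp only [hiff]
      · exact Disjoint.mono_right Finset.sdiff_subset (Finset.disjoint_filter_filter_not _ _ _)
    · intro I hI hI'
      rw [if_neg]
      intro hind
      refine hI' (Finset.mem_powerset.2 fun i hi => Finset.mem_filter.2
        ⟨Finset.mem_powerset.1 hI hi, fun hadj => ?_⟩)
      exact hind (Finset.mem_coe.2 (Finset.mem_insert_self p I))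
        (Finset.mem_coe.2 (Finset.mem_insert_of_mem hi)) hadj.ne hadj

/-- The determinant identity for disjoint unions of complete graphs: after pivoting on `p`, the
rows of the neighbours of `p` are diagonal. -/
lemma principalMinor_eq_indepSum
    (hH : ∀ u v w, H.Adj u v → H.Adj v w → u ≠ w → H.Adj u w) (S : Finset V) :
    principalMinor (diagonalAddAdj H d) S = indepSum H d S := by
  induction S using Finset.strongInduction with
  | H S ih =>
    rcases S.eq_empty_or_nonempty with rfl | ⟨p, hpS⟩
    · rw [principalMinor_empty, indepSum_empty]
    have hp := Finset.notMem_erase p S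
    have hlt := Finset.erase_ssubset hpS
    rw [← Finset.insert_erase hpS, principalMinor_insert_eq_add _ hp, indepSum_insert hp,
      diagonalAddAdj_self, ih _ hlt]
    set T := S.erase p
    have hne : ∀ i ∈ T, p ≠ i := fun i hi h => hp (h ▸ hi)
    rw [principalMinor_eq_prod_mul _ T {i ∈ T | H.Adj p i} (Finset.filter_subset _ _)]
    · rw [← Finset.filter_not, ← ih {i ∈ T | ¬ H.Adj p i}
        ((Finset.filter_subset _ _).trans_ssubset hlt)]
      congr 2
      · refine Finset.prod_congr rfl fun i hi => ?_
        obtain ⟨hiT, hadj⟩ := Finset.mem_filter.1 hi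
        rw [Matrix.sub_apply, Matrix.vecMulVec_apply, diagonalAddAdj_self,
          diagonalAddAdj_comm i p, diagonalAddAdj_of_ne (hne i hiT), if_pos hadj, mul_one]
      · refine principalMinor_congr fun i hi j hj => ?_
        obtain ⟨hjT, hj⟩ := Finset.mem_filter.1 hj
        rw [Matrix.sub_apply, Matrix.vecMulVec_apply, diagonalAddAdj_of_ne (hne j hjT), if_neg hj,
          mul_zero, sub_zero]
    · intro i hi j hj hji
      obtain ⟨hiT, hadj⟩ := Finset.mem_filter.1 hi
      rw [Matrix.sub_apply, Matrix.vecMulVec_apply, diagonalAddAdj_comm i p,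
        diagonalAddAdj_of_ne (hne i hiT), if_pos hadj, one_mul, diagonalAddAdj_of_ne hji.symm,
        diagonalAddAdj_of_ne (hne j hj), sub_eq_zero]
      have : H.Adj i j ↔ H.Adj p j :=
        ⟨fun h => hH _ _ _ hadj h (hne j hj), fun h => hH _ _ _ hadj.symm h hji.symm⟩
      simp only [this]

end IndependentSets

/-! ### The determinant is at most the independent set sum -/

section Inequality

variable {V : Type*} [DecidableEq V] {H : SimpleGraph V} [DecidableRel H.Adj] {d : V → ℝ}

lemma indepSum_nonneg {S : Finset V} (hd : ∀ i ∈ S, 1 ≤ d i) : 0 ≤ indepSum H d S := by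
  refine Finset.sum_nonneg fun I _ => ?_
  split_ifs
  · exact Finset.prod_nonneg fun i hi => sub_nonneg.2 (hd i (Finset.mem_sdiff.1 hi).1)
  · exact le_rfl

/-- The matrix that pivoting on `p`, as if its diagonal entry were `1`, leaves on the other
vertices. -/
def pivoted (H : SimpleGraph V) [DecidableRel H.Adj] (d : V → ℝ) (p : V) :
    Matrix V V ℝ :=
  diagonalAddAdj H d - Matrix.vecMulVec (diagonalAddAdj H d p) (diagonalAddAdj H d p)

lemma pivoted_of_not_adj {p i j : V} (hj : p ≠ j) (h : ¬ H.Adj p j) :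
    pivoted H d p i j = diagonalAddAdj H d i j := by
  rw [pivoted, Matrix.sub_apply, Matrix.vecMulVec_apply, diagonalAddAdj_of_ne hj, if_neg h,
    mul_zero, sub_zero]

lemma pivoted_of_adj {p i j : V} (hi : H.Adj p i) (hj : H.Adj p j) :
    pivoted H d p i j = diagonalAddAdj H d i j - 1 := by
  rw [pivoted, Matrix.sub_apply, Matrix.vecMulVec_apply, diagonalAddAdj_of_ne hi.ne, if_pos hi,
    diagonalAddAdj_of_ne hj.ne, if_pos hj, mul_one]

lemma principalMinor_insert_eq_add_pivoted {p : V} {T : Finset V} (hp : p ∉ T) :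
    principalMinor (diagonalAddAdj H d) (insert p T) =
      (d p - 1) * principalMinor (diagonalAddAdj H d) T + principalMinor (pivoted H d p) T := by
  have h : (fun i => diagonalAddAdj H d i p) = diagonalAddAdj H d p :=
    funext fun i => diagonalAddAdj_comm i p
  rw [principalMinor_insert_eq_add _ hp, diagonalAddAdj_self, h, pivoted]

lemma prod_pivoted {p : V} {T : Finset V} :
    ∏ i ∈ T with H.Adj p i, pivoted H d p i i = ∏ i ∈ T with H.Adj p i, (d i - 1) := by
  refine Finset.prod_congr rfl fun i hi => ?_
  have h := (Finset.mem_filter.1 hi).2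
  rw [pivoted_of_adj h h, diagonalAddAdj_self]

lemma principalMinor_pivoted_sdiff {p : V} {T : Finset V} (hp : p ∉ T) :
    principalMinor (pivoted H d p) (T \ {i ∈ T | H.Adj p i}) =
      principalMinor (diagonalAddAdj H d) {i ∈ T | ¬ H.Adj p i} := by
  rw [← Finset.filter_not]
  refine principalMinor_congr fun i _ j hj => ?_
  obtain ⟨hjT, hj⟩ := Finset.mem_filter.1 hj
  exact pivoted_of_not_adj (fun h => hp (h ▸ hjT)) hj

/-- Fischer's inequality for the pivoted matrix. If its determinant is not positive, there is
nothing to show; otherwise it is positive definite. -/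
lemma principalMinor_pivoted_le {p : V} {T : Finset V} (hp : p ∉ T)
    (hPD : PosDefOn (diagonalAddAdj H d) T) (hd : ∀ i ∈ T, 1 ≤ d i) :
    principalMinor (pivoted H d p) T ≤ (∏ i ∈ T with H.Adj p i, (d i - 1)) *
      principalMinor (diagonalAddAdj H d) {i ∈ T | ¬ H.Adj p i} := by
  by_cases h0 : 0 < principalMinor (pivoted H d p) T
  · have h := principalMinor_le_prod_mul (PosDefOn.sub_vecMulVec hPD h0)
      (Finset.filter_subset (H.Adj p) T)
    rwa [← pivoted, prod_pivoted, principalMinor_pivoted_sdiff hp] at h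
  · refine (not_lt.1 h0).trans (mul_nonneg (Finset.prod_nonneg fun i hi =>
      sub_nonneg.2 (hd i (Finset.mem_filter.1 hi).1)) ?_)
    exact (hPD.mono (Finset.filter_subset _ _)).principalMinor_pos.le

lemma principalMinor_pivoted_lt {p : V} {T : Finset V} (hp : p ∉ T)
    (hPD : PosDefOn (diagonalAddAdj H d) T) (hd : ∀ i ∈ T, H.Adj p i → 1 < d i)
    {u j : V} (hu : u ∈ T) (hpu : H.Adj p u) (hj : j ∈ T) (hju : j ≠ u)
    (huj : pivoted H d p u j ≠ 0) :
    principalMinor (pivoted H d p) T < (∏ i ∈ T with H.Adj p i, (d i - 1)) *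
      principalMinor (diagonalAddAdj H d) {i ∈ T | ¬ H.Adj p i} := by
  by_cases h0 : 0 < principalMinor (pivoted H d p) T
  · have h := principalMinor_lt_prod_mul (PosDefOn.sub_vecMulVec hPD h0)
      (Finset.filter_subset (H.Adj p) T) (Finset.mem_filter.2 ⟨hu, hpu⟩) hj hju huj
    rwa [← pivoted, prod_pivoted, principalMinor_pivoted_sdiff hp] at h
  · refine (not_lt.1 h0).trans_lt (mul_pos (Finset.prod_pos fun i hi =>
      sub_pos.2 (hd i (Finset.mem_filter.1 hi).1 (Finset.mem_filter.1 hi).2)) ?_)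
    exact (hPD.mono (Finset.filter_subset _ _)).principalMinor_pos

/-- A positive semidefinite principal submatrix is positive definite, or its determinant is `0`
and the bound is trivial; in the definite case one pivots and applies Fischer's inequality. -/
lemma principalMinor_le_indepSum {S : Finset V} (hd : ∀ i ∈ S, 1 ≤ d i)
    (hPSD : ((diagonalAddAdj H d).submatrix
      (Subtype.val : {x // x ∈ S} → V) Subtype.val).PosSemidef) :
    principalMinor (diagonalAddAdj H d) S ≤ indepSum H d S := by
  by_cases h0 : principalMinor (diagonalAddAdj H d) S = 0
  · exact h0.trans_le (indepSum_nonneg hd)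
  have hPD : PosDefOn (diagonalAddAdj H d) S :=
    hPSD.posDef_iff_isUnit.2 ((Matrix.isUnit_iff_isUnit_det _).2 (Ne.isUnit h0))
  clear h0 hPSD
  induction S using Finset.strongInduction with
  | H S ih =>
    rcases S.eq_empty_or_nonempty with rfl | ⟨p, hpS⟩
    · rw [principalMinor_empty, indepSum_empty]
    have hp := Finset.notMem_erase p S
    have hlt := Finset.erase_ssubset hpS
    have ih' : ∀ T ⊂ S, principalMinor (diagonalAddAdj H d) T ≤ indepSum H d T :=
      fun T hT => ih T hT (fun i hi => hd i (hT.1 hi)) (hPD.mono hT.1)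
    have hdT : ∀ i ∈ S.erase p, 1 ≤ d i := fun i hi => hd i (hlt.1 hi)
    rw [← Finset.insert_erase hpS, principalMinor_insert_eq_add_pivoted hp, indepSum_insert hp]
    refine add_le_add (mul_le_mul_of_nonneg_left (ih' _ hlt) (sub_nonneg.2 (hd p hpS)))
      ((principalMinor_pivoted_le hp (hPD.mono hlt.1) hdT).trans
        (mul_le_mul_of_nonneg_left (ih' _ ((Finset.filter_subset _ _).trans_ssubset hlt)) ?_))
    exact Finset.prod_nonneg fun i hi => sub_nonneg.2 (hdT i (Finset.mem_filter.1 hi).1)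

/-- A pivot `p` for which Fischer's inequality is strict makes the whole bound strict. -/
lemma principalMinor_lt_indepSum {p : V} {T : Finset V} (hp : p ∉ T)
    (hPD : PosDefOn (diagonalAddAdj H d) (insert p T)) (hd : ∀ i ∈ insert p T, 1 ≤ d i)
    (hd' : ∀ i ∈ T, H.Adj p i → 1 < d i)
    {u j : V} (hu : u ∈ T) (hpu : H.Adj p u) (hj : j ∈ T) (hju : j ≠ u)
    (huj : pivoted H d p u j ≠ 0) :
    principalMinor (diagonalAddAdj H d) (insert p T) < indepSum H d (insert p T) := by
  have hle : ∀ S ⊆ T, principalMinor (diagonalAddAdj H d) S ≤ indepSum H d S := fun S hS =>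
    principalMinor_le_indepSum (fun i hi => hd i (Finset.mem_insert_of_mem (hS hi)))
      (hPD.mono (hS.trans (Finset.subset_insert p T))).posSemidef
  rw [principalMinor_insert_eq_add_pivoted hp, indepSum_insert hp]
  refine add_lt_add_of_le_of_lt (mul_le_mul_of_nonneg_left (hle T subset_rfl)
    (sub_nonneg.2 (hd p (Finset.mem_insert_self p T))))
      ((principalMinor_pivoted_lt hp (hPD.mono (Finset.subset_insert p T)) hd' hu hpu hj hju
        huj).trans_le (mul_le_mul_of_nonneg_left (hle _ (Finset.filter_subset _ _)) ?_))
  exact Finset.prod_nonneg fun i hi =>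
    sub_nonneg.2 (hd i (Finset.mem_insert_of_mem (Finset.mem_filter.1 hi).1))

variable [Fintype V]

/-- The matrix is the sum of `B Bᵀ`, for the incidence matrix `B` of `H`, and of a nonnegative
diagonal matrix. -/
lemma posSemidef_diagonalAddAdj (hd : ∀ i, (H.degree i : ℝ) ≤ d i) :
    (diagonalAddAdj H d).PosSemidef := by
  have h : diagonalAddAdj H d = H.incMatrix ℝ * (H.incMatrix ℝ).conjTranspose +
      Matrix.diagonal (fun i => d i - H.degree i) := by
    rw [Matrix.conjTranspose_eq_transpose_of_trivial, SimpleGraph.incMatrix_mul_transpose]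
    ext i j
    by_cases hij : i = j
    · subst hij; simp [diagonalAddAdj_self]
    · simp [diagonalAddAdj_of_ne hij, hij]
  rw [h]
  exact (Matrix.posSemidef_self_mul_conjTranspose _).add
    (Matrix.PosSemidef.diagonal fun i => sub_nonneg.2 (hd i))

/-- Equality in `principalMinor_le_indepSum`, with a nonzero value, forces adjacency to be
transitive. If `u, v, w` is an induced path, one pivots on `v` if `d > 1` at all its neighbours,
and otherwise on a neighbour of `v` with `d = 1`, which has degree `1`. -/
lemma adj_of_det_eq_indepSum (hd : ∀ i, 1 ≤ d i) (hdeg : ∀ i, (H.degree i : ℝ) ≤ d i)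
    (heq : (diagonalAddAdj H d).det = indepSum H d Finset.univ)
    (hne : indepSum H d Finset.univ ≠ 0) {u v w : V}
    (huv : H.Adj u v) (hvw : H.Adj v w) (huw : u ≠ w) : H.Adj u w := by
  by_contra hnot
  have hPD : PosDefOn (diagonalAddAdj H d) Finset.univ := by
    refine ((posSemidef_diagonalAddAdj hdeg).submatrix _).posDef_iff_isUnit.2
      ((Matrix.isUnit_iff_isUnit_det _).2 (Ne.isUnit ?_))
    rw [← principalMinor, principalMinor_univ, heq]
    exact hne
  rw [← principalMinor_univ] at heq
  have key : ∀ p, (∀ i, H.Adj p i → 1 < d i) → ∀ x y, H.Adj p x → y ≠ p → y ≠ x →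
      pivoted H d p x y = 0 := by
    intro p hp x y hpx hyp hyx
    by_contra h
    have hi := Finset.insert_erase (Finset.mem_univ p)
    have hlt := principalMinor_lt_indepSum (Finset.notMem_erase p Finset.univ)
      (hi.symm ▸ hPD) (fun i _ => hd i) (fun i _ => hp i)
      (Finset.mem_erase.2 ⟨hpx.ne', Finset.mem_univ x⟩) hpx
      (Finset.mem_erase.2 ⟨hyp, Finset.mem_univ y⟩) hyx h
    rw [hi] at hlt
    exact hlt.ne heq
  by_cases hv : ∀ i, H.Adj v i → 1 < d i
  · have h := key v hv u w huv.symm hvw.ne' huw.symm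
    rw [pivoted_of_adj huv.symm hvw, diagonalAddAdj_of_ne huw, if_neg hnot] at h
    norm_num at h
  · push Not at hv
    obtain ⟨i, hvi, hdi⟩ := hv
    have hdeg1 : H.degree i ≤ 1 := by exact_mod_cast (hdeg i).trans hdi
    have honly : ∀ x, H.Adj i x → x = v := fun x hx =>
      Finset.card_le_one.1 hdeg1 x ((H.mem_neighborFinset i x).2 hx) v
        ((H.mem_neighborFinset i v).2 hvi.symm)
    have hdv : 1 < d v := by
      have h2 : 1 < H.degree v := Finset.one_lt_card.2
        ⟨u, (H.mem_neighborFinset v u).2 huv.symm, w, (H.mem_neighborFinset v w).2 hvw, huw⟩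
      exact lt_of_lt_of_le (by exact_mod_cast h2) (hdeg v)
    obtain ⟨y, hvy, hyi⟩ : ∃ y, H.Adj v y ∧ y ≠ i := by
      by_cases h : u = i
      · exact ⟨w, hvw, fun h' => huw (h.trans h'.symm)⟩
      · exact ⟨u, huv.symm, h⟩
    have h := key i (fun x hx => honly x hx ▸ hdv) v y hvi.symm hyi hvy.ne'
    rw [pivoted_of_not_adj hyi.symm (fun h => hvy.ne' (honly y h)),
      diagonalAddAdj_of_ne hvy.ne, if_pos hvy] at h
    exact one_ne_zero h

end Inequality

/-! ### Standard monomials of monomial ideals -/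

section StandardMonomials

/-- The monomials outside a monomial ideal form a basis of the quotient. -/
lemma finite_and_finrank_quotient_span_monomial (𝕂 : Type*) [Field 𝕂] {σ : Type*}
    (s : Set (σ →₀ ℕ)) (B : Finset (σ →₀ ℕ)) (hB : ∀ m, m ∈ B ↔ ¬ ∃ g ∈ s, g ≤ m) :
    Module.Finite 𝕂
      (MvPolynomial σ 𝕂 ⧸ Ideal.span ((fun g => MvPolynomial.monomial g (1 : 𝕂)) '' s)) ∧
    Module.finrank 𝕂
      (MvPolynomial σ 𝕂 ⧸ Ideal.span ((fun g => MvPolynomial.monomial g (1 : 𝕂)) '' s)) =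
        B.card := by
  classical
  set I := Ideal.span ((fun g => MvPolynomial.monomial g (1 : 𝕂)) '' s) with hI
  let φ : MvPolynomial σ 𝕂 →ₗ[𝕂] ({x // x ∈ B} → 𝕂) :=
    LinearMap.pi fun b => MvPolynomial.lcoeff 𝕂 b.1
  have hφ : ∀ p b, φ p b = MvPolynomial.coeff b.1 p := fun _ _ => rfl
  have hsurj : Function.Surjective φ := by
    intro f
    refine ⟨∑ b, MvPolynomial.monomial b.1 (f b), funext fun b => ?_⟩
    rw [hφ, MvPolynomial.coeff_sum, Finset.sum_eq_single b]
    · simp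
    · intro c _ hc
      rw [MvPolynomial.coeff_monomial, if_neg fun h => hc (Subtype.ext h)]
    · simp
  let π : MvPolynomial σ 𝕂 →ₗ[𝕂] MvPolynomial σ 𝕂 ⧸ I := (Ideal.Quotient.mkₐ 𝕂 I).toLinearMap
  have hπ : Function.Surjective π := Ideal.Quotient.mk_surjective
  have hker : LinearMap.ker π = LinearMap.ker φ := by
    ext p
    have h1 : p ∈ LinearMap.ker π ↔ p ∈ I := by
      rw [LinearMap.mem_ker]
      exact Ideal.Quotient.eq_zero_iff_mem
    rw [h1, hI, MvPolynomial.mem_ideal_span_monomial_image, LinearMap.mem_ker, funext_iff]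
    constructor
    · rintro h ⟨b, hb⟩
      by_contra h0
      exact (hB b).1 hb (h b (MvPolynomial.mem_support_iff.2 h0))
    · intro h m hm
      by_contra h0
      exact MvPolynomial.mem_support_iff.1 hm (h ⟨m, (hB m).2 h0⟩)
  let e := (π.quotKerEquivOfSurjective hπ).symm ≪≫ₗ
    Submodule.quotEquivOfEq _ _ hker ≪≫ₗ φ.quotKerEquivOfSurjective hsurj
  refine ⟨Module.Finite.equiv e.symm, ?_⟩
  rw [e.finrank_eq, Module.finrank_fintype_fun_eq_card, Fintype.card_coe]

variable {V : Type*} [Fintype V] [DecidableEq V] (H : SimpleGraph V)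
  [DecidableRel H.Adj]

/-- The exponent vectors that are less than `d` everywhere and attain the value `d i - 1` on an
independent set of vertices `i` only. The latter is encoded as `m i + 1 = d i`, to avoid truncated
subtraction. -/
def standardExponents (d : V → ℕ) : Finset (V → ℕ) :=
  {m ∈ Fintype.piFinset fun i => Finset.range (d i) |
    H.IsIndepSet (({i | m i + 1 = d i} : Finset V) : Set V)}

lemma mem_standardExponents {d m : V → ℕ} : m ∈ standardExponents H d ↔
    (∀ i, m i < d i) ∧ H.IsIndepSet (({i | m i + 1 = d i} : Finset V) : Set V) := by
  simp [standardExponents]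

/-- The exponent vectors are sorted by the independent set on which they attain `d i - 1`. -/
lemma card_standardExponents {d : V → ℕ} (hd : ∀ i, 1 ≤ d i) :
    ((standardExponents H d).card : ℤ) = indepSum H (fun i => (d i : ℤ)) Finset.univ := by
  rw [Finset.card_eq_sum_card_fiberwise (f := fun m : V → ℕ => ({i | m i + 1 = d i} : Finset V))
    (t := Finset.univ.powerset) (fun m _ => by simp), indepSum, Nat.cast_sum]
  refine Finset.sum_congr rfl fun I _ => ?_
  split_ifs with hI
  · have hfib : {m ∈ standardExponents H d | ({i | m i + 1 = d i} : Finset V) = I} =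
        Fintype.piFinset fun i => if i ∈ I then {d i - 1} else Finset.range (d i - 1) := by
      ext m
      simp only [Finset.mem_filter, mem_standardExponents, Fintype.mem_piFinset]
      constructor
      · rintro ⟨⟨h1, _⟩, rfl⟩ i
        have := h1 i
        by_cases hi : m i + 1 = d i
        · simp [hi]; omega
        · simp [hi]; omega
      · intro h
        have hset : ({i | m i + 1 = d i} : Finset V) = I := by
          ext i
          have h1 := h i
          have h2 := hd i
          by_cases hi : i ∈ I
          · simp only [hi, if_true, Finset.mem_singleton] at h1
            simp [hi]; omega
          · simp only [hi, if_false, Finset.mem_range] at h1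
            simp [hi]; omega
        refine ⟨⟨fun i => ?_, ?_⟩, hset⟩
        · have h1 := h i
          have h2 := hd i
          split_ifs at h1
          · rw [Finset.mem_singleton] at h1; omega
          · rw [Finset.mem_range] at h1; omega
        · rw [← hset] at hI
          simpa using hI
    rw [hfib, Fintype.card_piFinset, ← Finset.prod_sdiff (Finset.subset_univ I)]
    rw [Finset.prod_eq_one (s := I) (fun i hi => by simp [hi]), mul_one, Nat.cast_prod]
    refine Finset.prod_congr rfl fun i hi => ?_
    rw [if_neg (Finset.mem_sdiff.1 hi).2, Finset.card_range, Nat.cast_sub (hd i), Nat.cast_one]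
  · rw [Nat.cast_eq_zero, Finset.card_eq_zero, Finset.filter_eq_empty_iff]
    rintro m hm rfl
    refine hI ?_
    simpa using ((mem_standardExponents H).1 hm).2

end StandardMonomials

/-! ### Essentially connected components -/

section EssentialComponents

variable {α β : Type*} {G K : Graph α β} {r : α} {m c : ℕ}

lemma exists_isLink_of_edgeCount_ne_zero {x y : α} (h : edgeCount G x y ≠ 0) :
    ∃ e, G.IsLink e x y := by
  by_contra h0
  refine h ?_
  rw [edgeCount, Set.eq_empty_of_forall_notMem (s := {e | G.IsLink e x y})
    fun e he => h0 ⟨e, he⟩, Set.ncard_empty]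

/-- Off the root, the edges of `K` are determined by their ends. -/
lemma IsCompleteMultigraph.edge_unique (hK : IsCompleteMultigraph K r m c 1) {x y : α}
    (hx : x ≠ r) (hy : y ≠ r) {e f : β} (he : K.IsLink e x y) (hf : K.IsLink f x y) : e = f := by
  have hxy : x ≠ y := fun h => hK.loopless e x (by rw [← h] at he; exact he)
  obtain ⟨g, hg⟩ := Set.ncard_eq_one.1
    (hK.nonroot_edges x he.left_mem y he.right_mem hx hy hxy)
  have h1 : e ∈ ({g} : Set β) := hg ▸ he
  have h2 : f ∈ ({g} : Set β) := hg ▸ hf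
  exact h1.trans h2.symm

/-- If every essentially connected component arises from a complete multigraph by deletion of
edges at the root, adjacency of vertices off the root is transitive. -/
lemma adj_trans_of_essentialComponents
    (h : ∀ G₁, IsEssentialComponent G r G₁ → IsRootDeletedComplete G₁ r) {x y z : α}
    (hx : x ≠ r) (hy : y ≠ r) (hz : z ≠ r) (hxy : G.Adj x y) (hyz : G.Adj y z) (hxz : x ≠ z) :
    G.Adj x z := by
  set J := G.induce (G.vertexSet \ {r}) with hJ
  set C := {w | Relation.ReflTransGen J.Adj y w} with hC
  have hmem : ∀ w, w ≠ r → G.Adj y w → w ∈ C := by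
    rintro w hw ⟨e, he⟩
    exact Relation.ReflTransGen.single ⟨e, he, ⟨he.left_mem, hy⟩, ⟨he.right_mem, hw⟩⟩
  obtain ⟨m, c, K, _, hK, F, hF, heq⟩ := h (G.induce (insert r C))
    ⟨C, ⟨y, ⟨hxy.right_mem, hy⟩, rfl⟩, rfl⟩
  have hV : insert r C = K.vertexSet := by
    have := congrArg Graph.vertexSet heq
    simpa using this
  have hcount := hK.nonroot_edges x (hV ▸ Set.mem_insert_of_mem r (hmem x hx hxy.symm)) z
    (hV ▸ Set.mem_insert_of_mem r (hmem z hz hyz)) hx hz hxz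
  obtain ⟨e, he⟩ := exists_isLink_of_edgeCount_ne_zero (hcount.trans_ne one_ne_zero)
  have heF : e ∉ F := fun hmem => by
    rcases (hF e hmem).eq_or_eq_of_isLink he with h | h
    · exact hx h.symm
    · exact hz h.symm
  have hlink : (G.induce (insert r C)).IsLink e x z := by
    rw [heq, Graph.deleteEdges_isLink]
    exact ⟨he, heF⟩
  exact ⟨e, hlink.1⟩

lemma IsCompleteMultigraph.induce (hK : IsCompleteMultigraph K r m c 1) {C : Set α} (hr : r ∉ C)
    (hC : C ⊆ K.vertexSet) :
    IsCompleteMultigraph (K.induce (insert r C)) r C.ncard c 1 := by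
  have hfin : C.Finite := hK.finite.subset hC
  have hsub : insert r C ⊆ K.vertexSet := Set.insert_subset hK.root_mem hC
  have hcount : ∀ x ∈ insert r C, ∀ y ∈ insert r C,
      edgeCount (K.induce (insert r C)) x y = edgeCount K x y := by
    intro x hx y hy
    unfold edgeCount
    congr 1
    ext e
    exact ⟨fun h => h.1, fun h => ⟨h, hx, hy⟩⟩
  exact
    { finite := hfin.insert r
      card := Set.ncard_insert_of_notMem hr hfin
      root_mem := Set.mem_insert r C
      loopless := fun e x h => hK.loopless e x h.1
      root_edges := fun x hx hxr => by
        rw [hcount r (Set.mem_insert r C) x hx]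
        exact hK.root_edges x (hsub hx) hxr
      nonroot_edges := fun x hx y hy hxr hyr hxy => by
        rw [hcount x hx y hy]
        exact hK.nonroot_edges x (hsub hx) y (hsub hy) hxr hyr hxy }

/-- If adjacency of vertices off the root is transitive, an essentially connected component arises
from the complete multigraph that `K` induces on its vertices by deletion of edges at the root. -/
lemma isRootDeletedComplete_of_adj_trans (hc : 1 ≤ c) (hK : IsCompleteMultigraph K r m c 1)
    (hG : G ≤ K)
    (h : ∀ x y z, x ≠ r → y ≠ r → z ≠ r → G.Adj x y → G.Adj y z → x ≠ z → G.Adj x z)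
    {G₁ : Graph α β} (hG₁ : IsEssentialComponent G r G₁) : IsRootDeletedComplete G₁ r := by
  obtain ⟨C, ⟨v, hv, rfl⟩, rfl⟩ := hG₁
  set J := G.induce (G.vertexSet \ {r}) with hJ
  set C := {w | Relation.ReflTransGen J.Adj v w} with hC
  have hvr : v ≠ r := hv.2
  have hmem : ∀ w ∈ C, w ≠ r ∧ w ∈ G.vertexSet ∧ (v = w ∨ G.Adj v w) := by
    intro w hw
    induction hw with
    | refl => exact ⟨hvr, hv.1, Or.inl rfl⟩
    | @tail y z _ hyz ih =>
      obtain ⟨e, he, hy, hz⟩ := hyz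
      refine ⟨hz.2, hz.1, ?_⟩
      by_cases hvz : v = z
      · exact Or.inl hvz
      rcases ih.2.2 with rfl | hadj
      · exact Or.inr ⟨e, he⟩
      · exact Or.inr (h _ _ _ hvr hy.2 hz.2 hadj ⟨e, he⟩ hvz)
  have hadj : ∀ x ∈ C, ∀ y ∈ C, x ≠ y → G.Adj x y := by
    intro x hx y hy hxy
    obtain ⟨hxr, -, hx⟩ := hmem x hx
    obtain ⟨hyr, -, hy⟩ := hmem y hy
    rcases hx with rfl | hx
    · exact hy.resolve_left hxy
    rcases hy with rfl | hy
    · exact hx.symm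
    exact h _ _ _ hxr hvr hyr hx.symm hy hxy
  refine ⟨C.ncard, c, K.induce (insert r C), hc,
    hK.induce (fun hr => (hmem r hr).1 rfl) (fun w hw => hG.vertexSet_mono (hmem w hw).2.1),
    {e | (K.induce (insert r C)).Inc e r ∧ e ∉ G.edgeSet}, fun e he => he.1, ?_⟩
  refine Graph.ext (by simp) fun e x y => ?_
  rw [Graph.deleteEdges_isLink, Graph.induce_isLink, Graph.induce_isLink]
  constructor
  · rintro ⟨he, hxy⟩
    exact ⟨⟨he.mono hG, hxy⟩, fun hF => hF.2 he.edge_mem⟩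
  · rintro ⟨⟨he, hx, hy⟩, hF⟩
    refine ⟨?_, hx, hy⟩
    by_cases hroot : x = r ∨ y = r
    · have heG : e ∈ G.edgeSet := by
        by_contra heG
        refine hF ⟨?_, heG⟩
        rcases hroot with rfl | rfl
        · exact ⟨y, he, hx, hy⟩
        · exact ⟨x, he.symm, hy, hx⟩
      exact (hG.isLink_iff heG).2 he
    · push Not at hroot
      have hxy : x ≠ y := fun h => hK.loopless e x (by rw [← h] at he; exact he)
      obtain ⟨f, hf⟩ := hadj x (hx.resolve_left hroot.1) y (hy.resolve_left hroot.2) hxy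
      rwa [hK.edge_unique hroot.1 hroot.2 he (hf.mono hG)]

end EssentialComponents

/-! ### The skeleton ideal and the truncated signless Laplacian -/

section SkeletonIdeal

variable {β : Type*} {n a : ℕ} {K G : Graph (Fin (n + 1)) β}

/-- The simple graph on the vertices other than the root. -/
def nonrootGraph (G : Graph (Fin (n + 1)) β) : SimpleGraph (Fin n) where
  Adj i j := i ≠ j ∧ G.Adj i.succ j.succ
  symm := ⟨fun _ _ h => ⟨h.1.symm, h.2.symm⟩⟩
  loopless := ⟨fun _ h => h.1 rfl⟩

/-- The number of edges of `G` from the nonroot vertex `i.succ` to other vertices: its degree,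
as `G` has no loops in all that follows. -/
noncomputable def nonrootDegree (G : Graph (Fin (n + 1)) β) (i : Fin n) : ℕ :=
  cutDegree G {i.succ} i.succ

lemma edgeCount_self (hK : IsCompleteMultigraph K 0 n a 1) (hG : G ≤ K) (i : Fin (n + 1)) :
    edgeCount G i i = 0 := by
  by_contra h
  obtain ⟨e, he⟩ := exists_isLink_of_edgeCount_ne_zero h
  exact hK.loopless e i (he.mono hG)

lemma edgeCount_succ_succ [DecidableRel (nonrootGraph G).Adj]
    (hK : IsCompleteMultigraph K 0 n a 1) (hG : G ≤ K) (i j : Fin n) :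
    edgeCount G i.succ j.succ = if (nonrootGraph G).Adj i j then 1 else 0 := by
  split_ifs with h
  · obtain ⟨-, e, he⟩ := h
    rw [edgeCount, Set.ncard_eq_one]
    refine ⟨e, Set.eq_singleton_iff_unique_mem.2 ⟨he, fun f hf => ?_⟩⟩
    exact hK.edge_unique (Fin.succ_ne_zero i) (Fin.succ_ne_zero j) (Graph.IsLink.mono hG hf)
      (he.mono hG)
  · by_contra h0
    obtain ⟨e, he⟩ := exists_isLink_of_edgeCount_ne_zero h0
    refine h ⟨?_, e, he⟩
    rintro rfl
    exact hK.loopless e i.succ (he.mono hG)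

lemma nonrootDegree_eq [DecidableRel (nonrootGraph G).Adj]
    (hK : IsCompleteMultigraph K 0 n a 1) (hG : G ≤ K) (i : Fin n) :
    nonrootDegree G i = edgeCount G i.succ 0 + (nonrootGraph G).degree i := by
  have h := Finset.sum_add_sum_compl {i.succ} (fun j => edgeCount G i.succ j)
  rw [Finset.sum_singleton, edgeCount_self hK hG, zero_add, Fin.sum_univ_succ] at h
  rw [nonrootDegree, cutDegree, h]
  congr 1
  simp only [edgeCount_succ_succ hK hG, Finset.sum_boole, Nat.cast_id,
    ← SimpleGraph.card_neighborFinset_eq_degree]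
  congr 1
  ext j
  simp

lemma degree_le_nonrootDegree [DecidableRel (nonrootGraph G).Adj]
    (hK : IsCompleteMultigraph K 0 n a 1) (hG : G ≤ K) (i : Fin n) :
    (nonrootGraph G).degree i ≤ nonrootDegree G i := by
  rw [nonrootDegree_eq hK hG]
  exact Nat.le_add_left _ _

lemma truncatedSignlessLaplacian_eq [DecidableRel (nonrootGraph G).Adj]
    (hK : IsCompleteMultigraph K 0 n a 1) (hG : G ≤ K) :
    truncatedSignlessLaplacian G =
      diagonalAddAdj (nonrootGraph G) (fun i => (nonrootDegree G i : ℤ)) := by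
  ext i j
  rw [truncatedSignlessLaplacian, signlessLaplacian, Matrix.submatrix_apply, Matrix.add_apply,
    Matrix.of_apply]
  by_cases h : i = j
  · subst h
    rw [Matrix.diagonal_apply_eq, diagonalAddAdj_self, edgeCount_self hK hG, Nat.cast_zero,
      add_zero, nonrootDegree]
  · rw [Matrix.diagonal_apply_ne _ (fun h' => h (Fin.succ_injective n h')),
      diagonalAddAdj_of_ne h, edgeCount_succ_succ hK hG, zero_add]
    push_cast
    rfl

lemma cutDegree_pair_add [DecidableRel (nonrootGraph G).Adj]
    (hK : IsCompleteMultigraph K 0 n a 1) (hG : G ≤ K) {i j : Fin n} (h : i ≠ j) :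
    cutDegree G {i.succ, j.succ} i.succ + (if (nonrootGraph G).Adj i j then 1 else 0) =
      nonrootDegree G i := by
  have hne : i.succ ≠ j.succ := fun h' => h (Fin.succ_injective n h')
  have hins : ({i.succ} : Finset (Fin (n + 1)))ᶜ = insert j.succ ({i.succ, j.succ}ᶜ) := by
    ext x
    simp only [Finset.mem_compl, Finset.mem_singleton, Finset.mem_insert, not_or]
    constructor
    · intro hx
      by_cases hxj : x = j.succ
      · exact Or.inl hxj
      · exact Or.inr ⟨hx, hxj⟩
    · rintro (rfl | hx)
      · exact hne.symm
      · exact hx.1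
  rw [nonrootDegree, cutDegree, cutDegree, hins, Finset.sum_insert (by simp),
    edgeCount_succ_succ hK hG, add_comm]

/-- The exponent vectors of the generators of the ideal. -/
def generatorExponents (G : Graph (Fin (n + 1)) β) : Set (Fin n →₀ ℕ) :=
  {g | ∃ S : Finset (Fin n), S.Nonempty ∧ S.card ≤ 2 ∧
    g = ∑ i ∈ S, Finsupp.single i (cutDegree G (S.map (Fin.succEmb n)) i.succ)}

lemma skeletonIdeal_one_eq (𝕂 : Type*) [Field 𝕂] (G : Graph (Fin (n + 1)) β) :
    skeletonIdeal 𝕂 G 1 = Ideal.span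
      ((fun g => MvPolynomial.monomial g (1 : 𝕂)) '' generatorExponents G) := by
  have key : ∀ S : Finset (Fin n),
      MvPolynomial.monomial
        (∑ i ∈ S, Finsupp.single i (cutDegree G (S.map (Fin.succEmb n)) i.succ)) (1 : 𝕂) =
      ∏ i ∈ S, MvPolynomial.X i ^ cutDegree G (S.map (Fin.succEmb n)) i.succ := by
    intro S
    rw [MvPolynomial.monomial_sum_one]
    simp only [MvPolynomial.X_pow_eq_monomial]
  rw [skeletonIdeal]
  congr 1
  ext p
  constructor
  · rintro ⟨S, h1, h2, rfl⟩
    exact ⟨_, ⟨S, h1, h2, rfl⟩, key S⟩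
  · rintro ⟨_, ⟨S, h1, h2, rfl⟩, rfl⟩
    exact ⟨S, h1, h2, key S⟩

lemma sum_single_le_iff {σ : Type*} [DecidableEq σ] (S : Finset σ) (f : σ → ℕ) (m : σ →₀ ℕ) :
    ∑ i ∈ S, Finsupp.single i (f i) ≤ m ↔ ∀ i ∈ S, f i ≤ m i := by
  have h : ∀ j, (∑ i ∈ S, Finsupp.single i (f i)) j = if j ∈ S then f j else 0 := by
    intro j
    simp [Finsupp.finsetSum_apply, Finsupp.single_apply]
  constructor
  · intro hle i hi
    have := hle i
    rwa [h, if_pos hi] at this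
  · intro hm j
    rw [h]
    split_ifs with hj
    · exact hm j hj
    · exact Nat.zero_le _

/-- A monomial lies outside the ideal if and only if its exponent vector is standard: the
generators of singletons bound the exponents by the degrees, those of edges say that the bounds
are not attained at both ends of an edge, and those of non-edges are redundant. -/
lemma mem_standardExponents_iff [DecidableRel (nonrootGraph G).Adj]
    (hK : IsCompleteMultigraph K 0 n a 1) (hG : G ≤ K) (m : Fin n →₀ ℕ) :
    ⇑m ∈ standardExponents (nonrootGraph G) (nonrootDegree G) ↔
      ¬ ∃ g ∈ generatorExponents G, g ≤ m := by
  rw [mem_standardExponents]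
  constructor
  · rintro ⟨h1, h2⟩ ⟨_, ⟨S, hne, hcard, rfl⟩, hle⟩
    rw [sum_single_le_iff] at hle
    rcases (by have := hne.card_pos; omega : S.card = 1 ∨ S.card = 2) with h | h
    · obtain ⟨i, rfl⟩ := Finset.card_eq_one.1 h
      have := hle i (Finset.mem_singleton_self i)
      rw [Finset.map_singleton] at this
      exact (h1 i).not_ge this
    · obtain ⟨i, j, hij, rfl⟩ := Finset.card_eq_two.1 h
      have hi := hle i (by simp)
      have hj := hle j (by simp)
      simp only [Finset.map_insert, Finset.map_singleton, Fin.coe_succEmb] at hi hj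
      rw [Finset.pair_comm] at hj
      have hi' := cutDegree_pair_add hK hG hij
      have hj' := cutDegree_pair_add hK hG hij.symm
      have h1i := h1 i
      have h1j := h1 j
      by_cases hadj : (nonrootGraph G).Adj i j
      · rw [if_pos hadj] at hi'
        rw [if_pos hadj.symm] at hj'
        exact h2 (by simp; omega) (by simp; omega) hij hadj
      · rw [if_neg hadj] at hi'
        omega
  · intro h
    have h1 : ∀ i, m i < nonrootDegree G i := by
      intro i
      by_contra hi
      refine h ⟨_, ⟨{i}, Finset.singleton_nonempty i, by simp, rfl⟩, ?_⟩
      rw [sum_single_le_iff]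
      intro j hj
      obtain rfl := Finset.mem_singleton.1 hj
      rw [Finset.map_singleton]
      exact not_lt.1 hi
    refine ⟨h1, fun i hi j hj hij hadj => h ⟨_, ⟨{i, j}, by simp, Finset.card_le_two, rfl⟩, ?_⟩⟩
    simp only [Finset.coe_filter, Finset.mem_univ, true_and, Set.mem_ofPred_eq] at hi hj
    have hi' := cutDegree_pair_add hK hG hij
    have hj' := cutDegree_pair_add hK hG hij.symm
    rw [if_pos hadj] at hi'
    rw [if_pos hadj.symm, Finset.pair_comm] at hj'
    rw [sum_single_le_iff]
    intro k hk
    simp only [Finset.map_insert, Finset.map_singleton, Fin.coe_succEmb]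
    rcases Finset.mem_insert.1 hk with rfl | hk
    · omega
    · obtain rfl := Finset.mem_singleton.1 hk
      omega

lemma finite_and_finrank_quotient_skeletonIdeal (𝕂 : Type*) [Field 𝕂]
    [DecidableRel (nonrootGraph G).Adj] (hK : IsCompleteMultigraph K 0 n a 1) (hG : G ≤ K) :
    Module.Finite 𝕂 (MvPolynomial (Fin n) 𝕂 ⧸ skeletonIdeal 𝕂 G 1) ∧
    Module.finrank 𝕂 (MvPolynomial (Fin n) 𝕂 ⧸ skeletonIdeal 𝕂 G 1) =
      (standardExponents (nonrootGraph G) (nonrootDegree G)).card := by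
  rw [skeletonIdeal_one_eq, ← Finset.card_map (Finsupp.equivFunOnFinite.symm.toEmbedding)]
  refine finite_and_finrank_quotient_span_monomial 𝕂 _ _ fun m => ?_
  rw [← mem_standardExponents_iff hK hG, Finset.mem_map_equiv]
  rfl

end SkeletonIdeal

/-! ### Dimension and determinant -/

theorem mainTheorem1 (𝕂 : Type*) [Field 𝕂] {β : Type*} (n a : ℕ) (ha : 1 ≤ a)
    (K G : Graph (Fin (n + 1)) β) (hK : IsCompleteMultigraph K 0 n a 1)
    (hG : G.IsSpanningSubgraph K) :
    Module.Finite 𝕂 (MvPolynomial (Fin n) 𝕂 ⧸ skeletonIdeal 𝕂 G 1) ∧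
    ((∀ G₁ : Graph (Fin (n + 1)) β, IsEssentialComponent G 0 G₁ → IsRootDeletedComplete G₁ 0) →
      (Module.finrank 𝕂 (MvPolynomial (Fin n) 𝕂 ⧸ skeletonIdeal 𝕂 G 1) : ℤ) =
        (truncatedSignlessLaplacian G).det) ∧
    (skeletonIdeal 𝕂 G 1 ≠ ⊤ →
      (Module.finrank 𝕂 (MvPolynomial (Fin n) 𝕂 ⧸ skeletonIdeal 𝕂 G 1) : ℤ) =
        (truncatedSignlessLaplacian G).det →
      ∀ G₁ : Graph (Fin (n + 1)) β, IsEssentialComponent G 0 G₁ → IsRootDeletedComplete G₁ 0) := by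
  classical
  have hle : G ≤ K := hG.le
  obtain ⟨hfin, hrank⟩ := finite_and_finrank_quotient_skeletonIdeal 𝕂 hK hle
  refine ⟨hfin, fun hcomp => ?_, fun htop heq G₁ hG₁ => ?_⟩
  · rw [hrank, truncatedSignlessLaplacian_eq hK hle]
    by_cases hd : ∀ i, 1 ≤ nonrootDegree G i
    · rw [card_standardExponents _ hd, ← principalMinor_univ]
      refine (principalMinor_eq_indepSum (H := nonrootGraph G)
        (fun u v w huv hvw huw => ⟨huw, ?_⟩) _).symm
      exact adj_trans_of_essentialComponents hcomp (Fin.succ_ne_zero u) (Fin.succ_ne_zero v)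
        (Fin.succ_ne_zero w) huv.2 hvw.2 fun h => huw (Fin.succ_injective n h)
    · -- A vertex of degree `0` makes both sides vanish.
      push Not at hd
      obtain ⟨i, hi⟩ := hd
      have hi0 : nonrootDegree G i = 0 := by omega
      have hdeg : (nonrootGraph G).degree i = 0 :=
        Nat.le_zero.1 (hi0 ▸ degree_le_nonrootDegree hK hle i)
      rw [Matrix.det_eq_zero_of_row_eq_zero i, Nat.cast_eq_zero, Finset.card_eq_zero]
      · refine Finset.eq_empty_of_forall_notMem fun m hm => ?_
        have := ((mem_standardExponents _).1 hm).1 i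
        omega
      · intro j
        by_cases hij : i = j
        · rw [← hij, diagonalAddAdj_self, hi0, Nat.cast_zero]
        · rw [diagonalAddAdj_of_ne hij, if_neg]
          intro hadj
          exact (((nonrootGraph G).degree_pos_iff_exists_adj i).2 ⟨j, hadj⟩).ne' hdeg
  · -- The ideal is proper, so the dimension is not `0`; this excludes vertices of degree `0`.
    have hcard : (standardExponents (nonrootGraph G) (nonrootDegree G)).card ≠ 0 := by
      rw [← hrank]
      intro h0
      exact htop (Ideal.Quotient.subsingleton_iff.1 (Module.finrank_zero_iff.1 h0))
    have hd : ∀ i, 1 ≤ nonrootDegree G i := by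
      intro i
      obtain ⟨m, hm⟩ := Finset.card_ne_zero.1 hcard
      have := ((mem_standardExponents _).1 hm).1 i
      omega
    rw [hrank, card_standardExponents _ hd, truncatedSignlessLaplacian_eq hK hle] at heq
    rw [← Nat.cast_ne_zero (R := ℤ), card_standardExponents _ hd] at hcard
    have hmap : (diagonalAddAdj (nonrootGraph G) (fun i => (nonrootDegree G i : ℝ))) =
        (Int.castRingHom ℝ).mapMatrix
          (diagonalAddAdj (nonrootGraph G) (fun i => (nonrootDegree G i : ℤ))) := by
      ext i j
      by_cases hij : i = j
      · simp [hij, diagonalAddAdj_self]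
      · simp [diagonalAddAdj_of_ne hij, apply_ite]
    have hsum : indepSum (nonrootGraph G) (fun i => (nonrootDegree G i : ℝ)) Finset.univ =
        Int.castRingHom ℝ
          (indepSum (nonrootGraph G) (fun i => (nonrootDegree G i : ℤ)) Finset.univ) := by
      rw [map_indepSum]
      simp
    refine isRootDeletedComplete_of_adj_trans ha hK hle ?_ hG₁
    intro x y z hx hy hz hxy hyz hxz
    obtain ⟨u, rfl⟩ := Fin.exists_succ_eq.2 hx
    obtain ⟨v, rfl⟩ := Fin.exists_succ_eq.2 hy
    obtain ⟨w, rfl⟩ := Fin.exists_succ_eq.2 hz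
    have hne : ∀ i j : Fin n, G.Adj i.succ j.succ → i ≠ j := by
      rintro i j ⟨e, he⟩ rfl
      exact hK.loopless e _ (he.mono hle)
    refine (adj_of_det_eq_indepSum (H := nonrootGraph G)
      (d := fun i => (nonrootDegree G i : ℝ)) (fun i => by exact_mod_cast hd i)
      (fun i => by exact_mod_cast degree_le_nonrootDegree hK hle i) ?_ ?_
      ⟨hne u v hxy, hxy⟩ ⟨hne v w hyz, hyz⟩ (fun h => hxz (h ▸ rfl))).2
    · rw [hmap, hsum, ← RingHom.map_det, ← heq]
    · rw [hsum]
      simpa using hcard
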